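/- Let $\mathbb{F}$ be a field of characteristic different from $2$ and $3$. All Lie superalgebras are over $\mathbb{F}$ (possibly infinite-dimensional): $\mathbb{Z}_2$-graded vector spaces $L=L_{\bar 0}\oplus L_{\bar 1}$ with an even bilinear bracket that satisfies, for homogeneous elements, $[x,y]=-(-1)^{|x||y|}[y,x]$ and $(-1)^{|x||z|}[x,[y,z]]+(-1)^{|y||x|}[y,[z,x]]+(-1)^{|z||y|}[z,[x,y]]=0$. A graded ideal of $L$ is a graded subspace $I=(I\cap L_{\bar 0})\oplus(I\cap L_{\bar 1})$ with $[I,L]\subseteq I$; it is non-abelian if $[x,y]\neq 0$ for some $x,y\in I$. Let $I$ be a graded ideal of $L$. An action of $L$ on a Lie superalgebra $N$ is an even bilinear map $L\times N\to N$, $(l,n)\mapsto {}^{l}n$, with ${}^{[l,l']}n={}^{l}({}^{l'}n)-(-1)^{|l||l'|}\,{}^{l'}({}^{l}n)$ and ${}^{l}[n,n']=[{}^{l}n,n']+(-1)^{|l||n|}[n,{}^{l}n']$ for homogeneous elements. A relative central extension of $(L,I)$ is a homomorphism $\beta:N\to L$ of Lie superalgebras (even, linear, bracket-preserving) together with an action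 of $L$ on $N$ such that $\beta(N)=I$, $\beta({}^{l}n)=[l,\beta(n)]$, ${}^{\beta(n_1)}n=[n_1,n]$ for all $l\in L$, $n,n_1\in N$, and $\ker\beta\subseteq Z[L,N]:=\{n\in N\mid {}^{l}n=0 \text{ for all } l\in L\}$. The pair $(L,I)$ is capable if it has a relative central extension with $\ker\beta=Z[L,N]$. For $m,n\ge 0$ let $H(m,n)$ be the Lie superalgebra with basis $x_1,\dots,x_{2m},z$ (even) and $y_1,\dots,y_n$ (odd) whose only non-zero brackets of basis vectors are $[x_i,x_{m+i}]=z=-[x_{m+i},x_i]$ for $1\le i\le m$ and $[y_j,y_j]=z$ for $1\le j\le n$. For $m\ge 0$ let $H_m$ be the Lie superalgebra with basis $x_1,\dots,x_m$ (even) and $y_1,\dots,y_m,z$ (odd) whose only non-zero brackets of basis vectors are $[x_i,y_i]=z=-[y_i,x_i]$ for $1\le i\le m$. Then: (1) if $m+n\ge 2$ and $I$ is a non-abelian graded ideal of $H(m,n)$, the pair $(H(m,n),I)$ is not capable; (2) if $m\ge 2$ and $I$ is a non-abelian graded ideal of $H_m$, the pair $(H_m,I)$ is not capable. -/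

import Mathlib

universe u v w

/-- A Lie superalgebra over a field `F`: an `F`-vector space `L = L₀ ⊕ L₁` graded by `ZMod 2`, with
an even bilinear bracket that is graded skew-symmetric and satisfies the graded Jacobi identity. The
sign `(-1) ^ (|x| |y|)` is the unit `(-1 : ℤˣ) ^ (i * j)` for `|x| = i`, `|y| = j` in `ZMod 2`. -/
class LieSuperalgebra (F : Type u) (L : Type w) [Field F] [AddCommGroup L] [Module F L] where
  /-- The homogeneous parts `L₀` and `L₁`. -/
  gr : ZMod 2 → Submodule F L
  isInternal : DirectSum.IsInternal gr
  /-- The bracket. -/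
  br : L →ₗ[F] L →ₗ[F] L
  br_mem : ∀ (i j : ZMod 2) (x y : L), x ∈ gr i → y ∈ gr j → br x y ∈ gr (i + j)
  skew : ∀ (i j : ZMod 2) (x y : L), x ∈ gr i → y ∈ gr j →
    br x y = -((-1 : ℤˣ) ^ (i * j) • br y x)
  jacobi : ∀ (i j k : ZMod 2) (x y z : L), x ∈ gr i → y ∈ gr j → z ∈ gr k →
    (-1 : ℤˣ) ^ (i * k) • br x (br y z) + (-1 : ℤˣ) ^ (j * i) • br y (br z x)
      + (-1 : ℤˣ) ^ (k * j) • br z (br x y) = 0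

namespace LieSuperalgebra

section General

variable (F : Type u) [Field F]

/-- The homogeneous part of degree `i` of a Lie superalgebra. -/
abbrev part (L : Type w) [AddCommGroup L] [Module F L] [LieSuperalgebra F L] (i : ZMod 2) :
    Submodule F L :=
  LieSuperalgebra.gr i

/-- The bracket `[x, y]` of a Lie superalgebra over `F`. -/
abbrev bracket {L : Type w} [AddCommGroup L] [Module F L] [LieSuperalgebra F L] (x y : L) : L :=
  LieSuperalgebra.br (F := F) x y

variable {F}
variable {L : Type w} [AddCommGroup L] [Module F L] [LieSuperalgebra F L]
variable {N : Type v} [AddCommGroup N] [Module F N] [LieSuperalgebra F N]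

/-- A graded ideal `I` of `L`, that is, a subspace with `I = (I ∩ L₀) + (I ∩ L₁)` and
`[I, L] ⊆ I`. A pair of Lie superalgebras is `(L, I)` with `I` a graded ideal of `L`. -/
structure IsGradedIdeal (I : Submodule F L) : Prop where
  graded : I = (I ⊓ part F L 0) ⊔ (I ⊓ part F L 1)
  bracket_mem : ∀ x ∈ I, ∀ y : L, bracket F x y ∈ I

/-- A subspace on which the bracket vanishes; for a graded ideal, being an abelian one. -/
def IsAbelian (I : Submodule F L) : Prop :=
  ∀ x ∈ I, ∀ y ∈ I, bracket F x y = 0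

/-- Homomorphisms of Lie superalgebras: even linear maps that preserve the bracket. -/
structure IsHom (β : N →ₗ[F] L) : Prop where
  even : ∀ (i : ZMod 2), ∀ x ∈ part F N i, β x ∈ part F L i
  map_bracket : ∀ x y : N, β (bracket F x y) = bracket F (β x) (β y)

/-- Actions `(l, n) ↦ act l n` of a Lie superalgebra `L` on a Lie superalgebra `N`. -/
structure IsAction (act : L →ₗ[F] N →ₗ[F] N) : Prop where
  even : ∀ (i j : ZMod 2), ∀ l ∈ part F L i, ∀ n ∈ part F N j, act l n ∈ part F N (i + j)
  bracket_act : ∀ (i j : ZMod 2), ∀ l ∈ part F L i, ∀ l' ∈ part F L j, ∀ n : N,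
    act (bracket F l l') n = act l (act l' n) - (-1 : ℤˣ) ^ (i * j) • act l' (act l n)
  act_bracket : ∀ (i j : ZMod 2), ∀ l ∈ part F L i, ∀ n ∈ part F N j, ∀ n' : N,
    act l (bracket F n n') = bracket F (act l n) n' + (-1 : ℤˣ) ^ (i * j) • bracket F n (act l n')

/-- `Z[L, N] = {n ∈ N | act l n = 0 for all l ∈ L}`. -/
def relativeCenter (act : L →ₗ[F] N →ₗ[F] N) : Submodule F N where
  carrier := {n | ∀ l : L, act l n = 0}
  zero_mem' := fun l => map_zero (act l)
  add_mem' := fun {a b} ha hb l => by rw [map_add, ha l, hb l, add_zero]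
  smul_mem' := fun c a ha l => by rw [map_smul, ha l, smul_zero]

/-- A relative central extension of the pair `(L, I)`: a homomorphism `β : N → L` of Lie
superalgebras together with an action of `L` on `N`, subject to the four conditions below. -/
structure IsRelativeCentralExtension (I : Submodule F L) (β : N →ₗ[F] L)
    (act : L →ₗ[F] N →ₗ[F] N) : Prop where
  isHom : IsHom β
  isAction : IsAction act
  range_eq : LinearMap.range β = I
  map_act : ∀ (l : L) (n : N), β (act l n) = bracket F l (β n)
  act_map : ∀ n₁ n : N, act (β n₁) n = bracket F n₁ n
  ker_le : LinearMap.ker β ≤ relativeCenter act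

end General

/-- The pair `(L, I)` is capable: it has a relative central extension `β : N → L` (with `N` in the
universe `v`) such that `ker β = Z[L, N]`. -/
def IsCapablePair {F : Type u} [Field F] {L : Type w} [AddCommGroup L] [Module F L]
    [LieSuperalgebra F L] (I : Submodule F L) : Prop :=
  ∃ (N : Type v) (_ : AddCommGroup N) (_ : Module F N) (_ : LieSuperalgebra F N)
    (β : N →ₗ[F] L) (act : L →ₗ[F] N →ₗ[F] N),
    IsRelativeCentralExtension I β act ∧ LinearMap.ker β = relativeCenter act

section Parity

variable (F : Type u) [Field F] {ι : Type} (p : ι → ZMod 2)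

/-- For an index type `ι` with a parity, the vectors in `ι → F` supported on indices of
parity `i`. -/
def parityPart (i : ZMod 2) : Submodule F (ι → F) where
  carrier := {v | ∀ k, p k ≠ i → v k = 0}
  zero_mem' := fun _ _ => rfl
  add_mem' := fun {a b} ha hb k hk => by rw [Pi.add_apply, ha k hk, hb k hk, add_zero]
  smul_mem' := fun c a ha k hk => by rw [Pi.smul_apply, ha k hk, smul_zero]

theorem parityPart_isInternal : DirectSum.IsInternal (parityPart F p) := by
  have h01 : (0 : ZMod 2) ≠ 1 := by decide
  have hu : (Set.univ : Set (ZMod 2)) = {0, 1} := by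
    have h : ∀ i : ZMod 2, i = 0 ∨ i = 1 := by decide
    ext i; simpa using h i
  rw [DirectSum.isInternal_submodule_iff_isCompl _ h01 hu]
  constructor
  · rw [Submodule.disjoint_def]
    intro v h0 h1
    funext k
    by_cases hk : p k = 0
    · exact h1 k (by rw [hk]; exact h01)
    · exact h0 k hk
  · rw [codisjoint_iff, eq_top_iff]
    intro v _
    rw [Submodule.mem_sup]
    refine ⟨fun k => if p k = 0 then v k else 0, fun k hk => if_neg hk,
      fun k => if p k = 0 then 0 else v k, fun k hk => ?_, ?_⟩
    · have h : ∀ a : ZMod 2, a ≠ 1 → a = 0 := by decide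
      exact if_pos (h _ hk)
    · funext k
      by_cases hk : p k = 0 <;> simp [hk]

end Parity

end LieSuperalgebra

open LieSuperalgebra

/-- Names of the basis vectors of `H(m, n)`: `x i`, `x' i`, `y j`, `z` stand for
`x_i`, `x_{m+i}`, `y_j`, `z`. -/
inductive EvenHeisenbergIndex (m n : ℕ) : Type
  | x (i : Fin m)
  | x' (i : Fin m)
  | y (j : Fin n)
  | z

/-- The `y_j` are odd, all other basis vectors are even. -/
def EvenHeisenbergIndex.parity {m n : ℕ} : EvenHeisenbergIndex m n → ZMod 2
  | .y _ => 1
  | _ => 0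

/-- The vector space underlying the Heisenberg Lie superalgebra `H(m, n)` with even center: a vector
is given by its coordinates in the basis `x_1, …, x_{2m}, z` (even), `y_1, …, y_n` (odd). -/
abbrev EvenHeisenberg (F : Type u) (m n : ℕ) : Type u := EvenHeisenbergIndex m n → F

namespace EvenHeisenberg

variable (F : Type u) [Field F] (m n : ℕ)

variable {F m n}

/-- The bilinear form `B` with `[v, w] = B(v, w) z` on `H(m, n)`. -/
def form (v w : EvenHeisenberg F m n) : F :=
  (∑ i : Fin m, (v (.x i) * w (.x' i) - v (.x' i) * w (.x i))) + ∑ j : Fin n, v (.y j) * w (.y j)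

theorem form_add_left (v v' w : EvenHeisenberg F m n) :
    form (v + v') w = form v w + form v' w := by
  have h : ∀ k, (v + v') k = v k + v' k := fun _ => rfl
  simp only [form, h, add_mul, add_sub_add_comm, Finset.sum_add_distrib]
  ring

theorem form_smul_left (c : F) (v w : EvenHeisenberg F m n) :
    form (c • v) w = c * form v w := by
  have h : ∀ k, (c • v) k = c * v k := fun _ => rfl
  simp only [form, h, mul_assoc, ← mul_sub, ← Finset.mul_sum, ← mul_add]

theorem form_add_right (v w w' : EvenHeisenberg F m n) :
    form v (w + w') = form v w + form v w' := by
  have h : ∀ k, (w + w') k = w k + w' k := fun _ => rfl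
  simp only [form, h, mul_add, add_sub_add_comm, Finset.sum_add_distrib]
  ring

theorem form_smul_right (c : F) (v w : EvenHeisenberg F m n) :
    form v (c • w) = c * form v w := by
  have h : ∀ k, (c • w) k = c * w k := fun _ => rfl
  simp only [form, h, mul_left_comm _ c, ← mul_sub, ← Finset.mul_sum, ← mul_add]

/-- The multiple `c z` of the central basis vector. -/
def central (c : F) : EvenHeisenberg F m n
  | .z => c
  | _ => 0

theorem form_central (v : EvenHeisenberg F m n) (c : F) : form v (central c) = 0 := by
  simp [form, central]

variable (F m n)

/-- The bracket of `H(m, n)`: `[x_i, x_{m+i}] = z = -[x_{m+i}, x_i]`, `[y_j, y_j] = z`, and all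
other brackets of basis vectors vanish. -/
def br : EvenHeisenberg F m n →ₗ[F] EvenHeisenberg F m n →ₗ[F] EvenHeisenberg F m n :=
  LinearMap.mk₂ F (fun v w => central (form v w))
    (fun v v' w => by
      rw [form_add_left]; funext k; cases k
      · exact (add_zero 0).symm
      · exact (add_zero 0).symm
      · exact (add_zero 0).symm
      · rfl)
    (fun c v w => by
      rw [form_smul_left]; funext k; cases k
      · exact (mul_zero c).symm
      · exact (mul_zero c).symm
      · exact (mul_zero c).symm
      · rfl)
    (fun v w w' => by
      rw [form_add_right]; funext k; cases k
      · exact (add_zero 0).symm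
      · exact (add_zero 0).symm
      · exact (add_zero 0).symm
      · rfl)
    (fun c v w => by
      rw [form_smul_right]; funext k; cases k
      · exact (mul_zero c).symm
      · exact (mul_zero c).symm
      · exact (mul_zero c).symm
      · rfl)

theorem br_br (u v w : EvenHeisenberg F m n) : br F m n u (br F m n v w) = 0 := by
  change central (form u (central (form v w))) = 0
  rw [form_central]
  funext k; cases k <;> rfl

/-- The Heisenberg Lie superalgebra `H(m, n)`. -/
instance : LieSuperalgebra F (EvenHeisenberg F m n) where
  gr := parityPart F EvenHeisenbergIndex.parity
  isInternal := parityPart_isInternal F EvenHeisenbergIndex.parity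
  br := br F m n
  br_mem := fun i j v w hv hw k hk => by
    have hv' : ∀ k, EvenHeisenbergIndex.parity k ≠ i → v k = 0 := hv
    have hw' : ∀ k, EvenHeisenbergIndex.parity k ≠ j → w k = 0 := hw
    cases k with
    | x => rfl
    | x' => rfl
    | y => rfl
    | z =>
      change form v w = 0
      have h : ∀ i j : ZMod 2, (0 : ZMod 2) ≠ i + j → (i = 0 ∧ j = 1) ∨ (i = 1 ∧ j = 0) := by
        decide
      rcases h i j hk with ⟨rfl, rfl⟩ | ⟨rfl, rfl⟩
      · have h1 : ∀ k, w (.x k) = 0 := fun k => hw' _ zero_ne_one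
        have h2 : ∀ k, w (.x' k) = 0 := fun k => hw' _ zero_ne_one
        have h3 : ∀ k, v (.y k) = 0 := fun k => hv' _ one_ne_zero
        simp [form, h1, h2, h3]
      · have h1 : ∀ k, v (.x k) = 0 := fun k => hv' _ zero_ne_one
        have h2 : ∀ k, v (.x' k) = 0 := fun k => hv' _ zero_ne_one
        have h3 : ∀ k, w (.y k) = 0 := fun k => hw' _ one_ne_zero
        simp [form, h1, h2, h3]
  skew := fun i j v w hv hw => by
    have hv' : ∀ k, EvenHeisenbergIndex.parity k ≠ i → v k = 0 := hv
    have hw' : ∀ k, EvenHeisenbergIndex.parity k ≠ j → w k = 0 := hw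
    have key : form v w = -((-1 : ℤˣ) ^ (i * j) • form w v) := by
      have h : ∀ i : ZMod 2, i = 0 ∨ i = 1 := by decide
      rcases h i with rfl | rfl
      · have h3 : ∀ k, v (.y k) = 0 := fun k => hv' _ one_ne_zero
        simp only [form, h3, zero_mul, mul_zero, Finset.sum_const_zero, add_zero, uzpow_zero,
          one_smul, ← Finset.sum_neg_distrib]
        exact Finset.sum_congr rfl fun k _ => by ring
      · have h1 : ∀ k, v (.x k) = 0 := fun k => hv' _ zero_ne_one
        have h2 : ∀ k, v (.x' k) = 0 := fun k => hv' _ zero_ne_one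
        rcases h j with rfl | rfl
        · have h3 : ∀ k, w (.y k) = 0 := fun k => hw' _ one_ne_zero
          simp [form, h1, h2, h3]
        · simp only [form, h1, h2, zero_mul, mul_zero, sub_zero, Finset.sum_const_zero, zero_add,
            mul_one, uzpow_one, Units.neg_smul, one_smul, neg_neg]
          exact Finset.sum_congr rfl fun k _ => mul_comm _ _
    funext k
    cases k with
    | x => exact (neg_eq_zero.mpr (smul_zero ((-1 : ℤˣ) ^ (i * j)))).symm
    | x' => exact (neg_eq_zero.mpr (smul_zero ((-1 : ℤˣ) ^ (i * j)))).symm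
    | y => exact (neg_eq_zero.mpr (smul_zero ((-1 : ℤˣ) ^ (i * j)))).symm
    | z => exact key
  jacobi := fun i j k u v w _ _ _ => by
    rw [br_br, br_br, br_br, smul_zero, smul_zero, smul_zero, add_zero, add_zero]

end EvenHeisenberg

/-- Names of the basis vectors of `H_m`: `x i`, `y i`, `z` stand for `x_i`, `y_i`, `z`. -/
inductive OddHeisenbergIndex (m : ℕ) : Type
  | x (i : Fin m)
  | y (i : Fin m)
  | z

/-- The `x_i` are even, the `y_i` and `z` are odd. -/
def OddHeisenbergIndex.parity {m : ℕ} : OddHeisenbergIndex m → ZMod 2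
  | .x _ => 0
  | _ => 1

/-- The vector space underlying the Heisenberg Lie superalgebra `H_m` with odd center: a vector
is given by its coordinates in the basis `x_1, …, x_m` (even), `y_1, …, y_m, z` (odd). -/
abbrev OddHeisenberg (F : Type u) (m : ℕ) : Type u := OddHeisenbergIndex m → F

namespace OddHeisenberg

variable (F : Type u) [Field F] (m : ℕ)

variable {F m}

/-- The bilinear form `B` with `[v, w] = B(v, w) z` on `H_m`. -/
def form (v w : OddHeisenberg F m) : F :=
  ∑ i : Fin m, (v (.x i) * w (.y i) - v (.y i) * w (.x i))

theorem form_add_left (v v' w : OddHeisenberg F m) :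
    form (v + v') w = form v w + form v' w := by
  have h : ∀ k, (v + v') k = v k + v' k := fun _ => rfl
  simp only [form, h, add_mul, add_sub_add_comm, Finset.sum_add_distrib]

theorem form_smul_left (c : F) (v w : OddHeisenberg F m) :
    form (c • v) w = c * form v w := by
  have h : ∀ k, (c • v) k = c * v k := fun _ => rfl
  simp only [form, h, mul_assoc, ← mul_sub, ← Finset.mul_sum]

theorem form_swap (v w : OddHeisenberg F m) : form v w = -form w v := by
  simp only [form, ← Finset.sum_neg_distrib]
  exact Finset.sum_congr rfl fun k _ => by ring

theorem form_add_right (v w w' : OddHeisenberg F m) :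
    form v (w + w') = form v w + form v w' := by
  rw [form_swap, form_add_left, neg_add, ← form_swap, ← form_swap]

theorem form_smul_right (c : F) (v w : OddHeisenberg F m) :
    form v (c • w) = c * form v w := by
  rw [form_swap, form_smul_left, ← mul_neg, ← form_swap]

/-- The multiple `c z` of the central basis vector. -/
def central (c : F) : OddHeisenberg F m
  | .z => c
  | _ => 0

theorem form_central (v : OddHeisenberg F m) (c : F) : form v (central c) = 0 := by
  simp [form, central]

variable (F m)

/-- The bracket of `H_m`: `[x_i, y_i] = z = -[y_i, x_i]`, and all other brackets of basis vectors
vanish. -/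
def br : OddHeisenberg F m →ₗ[F] OddHeisenberg F m →ₗ[F] OddHeisenberg F m :=
  LinearMap.mk₂ F (fun v w => central (form v w))
    (fun v v' w => by
      rw [form_add_left]; funext k; cases k
      · exact (add_zero 0).symm
      · exact (add_zero 0).symm
      · rfl)
    (fun c v w => by
      rw [form_smul_left]; funext k; cases k
      · exact (mul_zero c).symm
      · exact (mul_zero c).symm
      · rfl)
    (fun v w w' => by
      rw [form_add_right]; funext k; cases k
      · exact (add_zero 0).symm
      · exact (add_zero 0).symm
      · rfl)
    (fun c v w => by
      rw [form_smul_right]; funext k; cases k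
      · exact (mul_zero c).symm
      · exact (mul_zero c).symm
      · rfl)

theorem br_br (u v w : OddHeisenberg F m) : br F m u (br F m v w) = 0 := by
  change central (form u (central (form v w))) = 0
  rw [form_central]
  funext k; cases k <;> rfl

/-- The Heisenberg Lie superalgebra `H_m`. -/
instance : LieSuperalgebra F (OddHeisenberg F m) where
  gr := parityPart F OddHeisenbergIndex.parity
  isInternal := parityPart_isInternal F OddHeisenbergIndex.parity
  br := br F m
  br_mem := fun i j v w hv hw k hk => by
    have hv' : ∀ k, OddHeisenbergIndex.parity k ≠ i → v k = 0 := hv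
    have hw' : ∀ k, OddHeisenbergIndex.parity k ≠ j → w k = 0 := hw
    cases k with
    | x => rfl
    | y => rfl
    | z =>
      change form v w = 0
      have h : ∀ i j : ZMod 2, (1 : ZMod 2) ≠ i + j → (i = 0 ∧ j = 0) ∨ (i = 1 ∧ j = 1) := by
        decide
      rcases h i j hk with ⟨rfl, rfl⟩ | ⟨rfl, rfl⟩
      · have h1 : ∀ k, v (.y k) = 0 := fun k => hv' _ one_ne_zero
        have h2 : ∀ k, w (.y k) = 0 := fun k => hw' _ one_ne_zero
        simp [form, h1, h2]
      · have h1 : ∀ k, v (.x k) = 0 := fun k => hv' _ zero_ne_one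
        have h2 : ∀ k, w (.x k) = 0 := fun k => hw' _ zero_ne_one
        simp [form, h1, h2]
  skew := fun i j v w hv hw => by
    have hv' : ∀ k, OddHeisenbergIndex.parity k ≠ i → v k = 0 := hv
    have hw' : ∀ k, OddHeisenbergIndex.parity k ≠ j → w k = 0 := hw
    have key : form v w = -((-1 : ℤˣ) ^ (i * j) • form w v) := by
      have h : ∀ i j : ZMod 2, i * j = 0 ∨ (i = 1 ∧ j = 1) := by decide
      rcases h i j with h0 | ⟨rfl, rfl⟩
      · rw [h0, uzpow_zero, one_smul, form_swap]
      · have h1 : ∀ k, v (.x k) = 0 := fun k => hv' _ zero_ne_one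
        have h2 : ∀ k, w (.x k) = 0 := fun k => hw' _ zero_ne_one
        simp [form, h1, h2]
    funext k
    cases k with
    | x => exact (neg_eq_zero.mpr (smul_zero ((-1 : ℤˣ) ^ (i * j)))).symm
    | y => exact (neg_eq_zero.mpr (smul_zero ((-1 : ℤˣ) ^ (i * j)))).symm
    | z => exact key
  jacobi := fun i j k u v w _ _ _ => by
    rw [br_br, br_br, br_br, smul_zero, smul_zero, smul_zero, add_zero, add_zero]

end OddHeisenberg

/-! ### Homogeneous elements and the obstruction to capability -/

namespace LieSuperalgebra

section General

variable {F : Type u} [Field F]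
variable {L : Type w} [AddCommGroup L] [Module F L] [LieSuperalgebra F L]
variable {N : Type v} [AddCommGroup N] [Module F N] [LieSuperalgebra F N]

/-! In a Heisenberg superalgebra all brackets are multiples of `z`, so one non-zero bracket can
stand in for another. Suppose `a, b ∈ I` and `c, d ∈ L` are homogeneous, `[a, b]` and `[c, d]` are
both non-zero, and `c, d` commute with `a, b`. Given a relative central extension with `ker β = Z[L,
N]`, lift `a, b` to homogeneous `a', b'`. The action of `[a, b]` is a multiple of that of `[c, d]`,
hence a combination of "`c` after `d`" and "`d` after `c`". On `a'` and `b'` both composites vanish: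
the inner step lands in `ker β`, which `L` annihilates. From this and the derivation rule, all of
`L` annihilates `[a', b']`, so `[a', b'] ∈ ker β` and `[a, b] = 0`, a contradiction. This is
`not_isCapablePair_of_commuting`.

What remains is linear algebra of the form `B`, non-degenerate modulo `z`. A non-abelian graded
ideal contains a homogeneous pair with `B(a, b) ≠ 0`. The span of such a pair, or of one anisotropic
odd vector, splits off orthogonally, and the bound on `m + n` or `m` leaves a complement on which
`B` is non-zero; `c, d` are taken there. These are the lemmas `exists_orthogonal_of_even`,
`exists_orthogonal_of_odd` and `exists_orthogonal`. -/

theorem isCompl_part : IsCompl (part F L 0) (part F L 1) := by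
  have hu : (Set.univ : Set (ZMod 2)) = {0, 1} := by
    have h : ∀ i : ZMod 2, i = 0 ∨ i = 1 := by decide
    ext i; simpa using h i
  exact (DirectSum.isInternal_submodule_iff_isCompl _ (by decide) hu).1
    (LieSuperalgebra.isInternal (F := F) (L := L))

theorem exists_add_part (x : L) : ∃ x₀ ∈ part F L 0, ∃ x₁ ∈ part F L 1, x₀ + x₁ = x := by
  have h : x ∈ part F L 0 ⊔ part F L 1 := by
    rw [isCompl_part.sup_eq_top]; exact Submodule.mem_top
  exact Submodule.mem_sup.1 h

/-- A homogeneous element of the image of a homomorphism has a homogeneous preimage. -/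
theorem IsHom.exists_part_preimage {β : N →ₗ[F] L} (hβ : IsHom β) {i : ZMod 2} {a : L}
    (ha : a ∈ part F L i) (har : a ∈ LinearMap.range β) : ∃ a' ∈ part F N i, β a' = a := by
  obtain ⟨n, rfl⟩ := har
  obtain ⟨n₀, hn₀, n₁, hn₁, rfl⟩ := exists_add_part (F := F) n
  have h0 := hβ.even 0 n₀ hn₀
  have h1 := hβ.even 1 n₁ hn₁
  have hd := Submodule.disjoint_def.1 (isCompl_part (F := F) (L := L)).disjoint
  have hi : ∀ i : ZMod 2, i = 0 ∨ i = 1 := by decide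
  rw [map_add] at ha
  -- The image of the component of the other parity lies in both `L₀` and `L₁`, so it vanishes and
  -- that component can be dropped.
  rcases hi i with rfl | rfl
  · refine ⟨n₀, hn₀, ?_⟩
    rw [map_add, hd _ ((Submodule.add_mem_iff_right _ h0).1 ha) h1, add_zero]
  · refine ⟨n₁, hn₁, ?_⟩
    rw [map_add, hd _ h0 ((Submodule.add_mem_iff_left _ h1).1 ha), zero_add]

/-- A non-abelian graded ideal contains homogeneous elements with non-zero bracket. -/
theorem IsGradedIdeal.exists_part_bracket_ne_zero {I : Submodule F L} (hI : IsGradedIdeal I)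
    (hna : ¬ IsAbelian I) :
    ∃ i j : ZMod 2, ∃ a ∈ I ⊓ part F L i, ∃ b ∈ I ⊓ part F L j, bracket F a b ≠ 0 := by
  by_contra! h
  refine hna fun x hx y hy => ?_
  rw [hI.graded] at hx hy
  obtain ⟨x₀, hx₀, x₁, hx₁, rfl⟩ := Submodule.mem_sup.1 hx
  obtain ⟨y₀, hy₀, y₁, hy₁, rfl⟩ := Submodule.mem_sup.1 hy
  have h00 := h 0 0 x₀ hx₀ y₀ hy₀
  have h01 := h 0 1 x₀ hx₀ y₁ hy₁
  have h10 := h 1 0 x₁ hx₁ y₀ hy₀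
  have h11 := h 1 1 x₁ hx₁ y₁ hy₁
  simp only [map_add, LinearMap.add_apply, h00, h01, h10, h11, add_zero]

/-- Suppose that the derived algebra of `L` is at most one-dimensional. If there are homogeneous
`a, b ∈ I` and `c, d ∈ L` with `[a, b] ≠ 0 ≠ [c, d]` such that `c, d` commute with `a, b`, then
`(L, I)` is not capable: for lifts `a', b'` of `a, b`, all of `L` annihilates `[a', b']`. -/
theorem not_isCapablePair_of_commuting {I : Submodule F L}
    (hL : ∀ e f x y : L, bracket F e f ≠ 0 → ∃ s : F, bracket F x y = s • bracket F e f)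
    {i j k l : ZMod 2} {a b c d : L}
    (ha : a ∈ I ⊓ part F L i) (hb : b ∈ I ⊓ part F L j) (hc : c ∈ part F L k)
    (hd : d ∈ part F L l) (hab : bracket F a b ≠ 0) (hcd : bracket F c d ≠ 0)
    (hca : bracket F c a = 0) (hcb : bracket F c b = 0)
    (hda : bracket F d a = 0) (hdb : bracket F d b = 0) :
    ¬ IsCapablePair.{u, v, w} I := by
  rintro ⟨N, _, _, _, β, act, h, hker⟩
  have act_ker : ∀ n : N, β n = 0 → ∀ x : L, act x n = 0 := fun n hn => h.ker_le hn
  obtain ⟨a', ha', rfl⟩ := h.isHom.exists_part_preimage ha.2 (h.range_eq ▸ ha.1)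
  obtain ⟨b', hb', rfl⟩ := h.isHom.exists_part_preimage hb.2 (h.range_eq ▸ hb.1)
  -- If `c, d` commute with `β n`, then `act c n` and `act d n` lie in `ker β`, so both terms of the
  -- action of `[c, d]` on `n` vanish.
  have hact : ∀ n : N, bracket F c (β n) = 0 → bracket F d (β n) = 0 →
      act (bracket F (β a') (β b')) n = 0 := by
    intro n hcn hdn
    obtain ⟨s, hs⟩ := hL c d (β a') (β b') hcd
    rw [hs, map_smul, LinearMap.smul_apply, h.isAction.bracket_act k l c hc d hd,
      act_ker (act d n) (by rw [h.map_act, hdn]), act_ker (act c n) (by rw [h.map_act, hcn]),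
      smul_zero, sub_zero, smul_zero]
  have haa : act (β a') (bracket F a' b') = 0 := by
    have h0 : bracket F (bracket F a' b') a' = 0 := by
      rw [← h.act_map, h.isHom.map_bracket, hact a' hca hda]
    rw [h.act_map]
    refine (LieSuperalgebra.skew _ _ _ _ ha'
      (LieSuperalgebra.br_mem _ _ _ _ ha' hb')).trans ?_
    rw [show LieSuperalgebra.br (F := F) (LieSuperalgebra.br (F := F) a' b') a' = 0 from h0,
      smul_zero, neg_zero]
  have hhom : ∀ (r : ZMod 2), ∀ x ∈ part F L r, act x (bracket F a' b') = 0 := by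
    intro r x hx
    -- `act x a'` lies over `[x, a]`, a multiple of `[a, b]`, so bracketing with it is a multiple of
    -- the action of `[a, b]`, which kills `b'`.
    have h1 : bracket F (act x a') b' = 0 := by
      obtain ⟨s, hs⟩ := hL (β a') (β b') x (β a') hab
      rw [← h.act_map, h.map_act, hs, map_smul, LinearMap.smul_apply, hact b' hcb hdb, smul_zero]
    have h2 : bracket F a' (act x b') = 0 := by
      obtain ⟨s, hs⟩ := hL (β a') (β b') x (β b') hab
      -- `act x b'` agrees with `s • [a', b']` modulo `ker β`, and `a` annihilates both `ker β` and
      -- `[a', b']`.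
      have h3 := act_ker (act x b' - s • bracket F a' b')
        (by rw [map_sub, map_smul, h.map_act, h.isHom.map_bracket, hs, sub_self]) (β a')
      rwa [map_sub, map_smul, haa, smul_zero, sub_zero, h.act_map] at h3
    rw [h.isAction.act_bracket r i x hx a' ha', h1, h2, smul_zero, add_zero]
  have hmem : bracket F a' b' ∈ LinearMap.ker β := by
    rw [hker]
    intro x
    obtain ⟨x₀, hx₀, x₁, hx₁, rfl⟩ := exists_add_part (F := F) x
    rw [map_add, LinearMap.add_apply, hhom 0 x₀ hx₀, hhom 1 x₁ hx₁, add_zero]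
  apply hab
  rw [← h.isHom.map_bracket]
  exact hmem

end General

end LieSuperalgebra

/-- The dimension count that turns the bounds on `m` and `n` into a non-zero vector `c` satisfying
the orthogonality conditions. -/
theorem exists_ne_zero_map_eq_zero {F V W : Type*} [Field F] [AddCommGroup V] [Module F V]
    [FiniteDimensional F V] [AddCommGroup W] [Module F W] [FiniteDimensional F W]
    (φ : V →ₗ[F] W) (h : Module.finrank F W < Module.finrank F V) : ∃ v, v ≠ 0 ∧ φ v = 0 := by
  obtain ⟨v, hv, hv0⟩ := Submodule.exists_mem_ne_zero_of_ne_bot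
    (LinearMap.ker_ne_bot_of_finrank_lt (f := φ) h)
  exact ⟨v, hv0, hv⟩

/-! ### The form on `H(m, n)`: orthogonal complements and non-capability -/

namespace EvenHeisenberg

variable {F : Type u} [Field F] {m n : ℕ}

theorem bracket_eq_central (v w : EvenHeisenberg F m n) :
    bracket F v w = central (form v w) := rfl

theorem bracket_eq_zero_iff (v w : EvenHeisenberg F m n) :
    bracket F v w = 0 ↔ form v w = 0 := by
  rw [bracket_eq_central]
  refine ⟨fun h => congrFun h .z, fun h => ?_⟩
  rw [h]; funext k; cases k <;> rfl

theorem exists_bracket_eq_smul (e f v w : EvenHeisenberg F m n) (h : bracket F e f ≠ 0) :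
    ∃ s : F, bracket F v w = s • bracket F e f := by
  rw [Ne, bracket_eq_zero_iff] at h
  refine ⟨form v w / form e f, ?_⟩
  rw [bracket_eq_central, bracket_eq_central]
  funext k
  cases k
  · exact (mul_zero _).symm
  · exact (mul_zero _).symm
  · exact (mul_zero _).symm
  · exact (div_mul_cancel₀ _ h).symm

/-- The vector with given coordinates and no `z`-component. -/
def mk (p q : Fin m → F) (r : Fin n → F) : EvenHeisenberg F m n
  | .x i => p i
  | .x' i => q i
  | .y j => r j
  | .z => 0

theorem mk_add (p p' q q' : Fin m → F) (r r' : Fin n → F) :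
    (mk (p + p') (q + q') (r + r') : EvenHeisenberg F m n) = mk p q r + mk p' q' r' := by
  funext k; cases k <;> simp only [mk, Pi.add_apply, add_zero]

theorem mk_smul (s : F) (p q : Fin m → F) (r : Fin n → F) :
    (mk (s • p) (s • q) (s • r) : EvenHeisenberg F m n) = s • mk p q r := by
  funext k; cases k <;> simp only [mk, Pi.smul_apply, smul_zero]

theorem mk_mem_zero (p q : Fin m → F) : (mk p q 0 : EvenHeisenberg F m n) ∈
    part F (EvenHeisenberg F m n) 0 := by
  intro k hk
  cases k with
  | y j => rfl
  | _ => exact absurd rfl hk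

theorem mk_mem_one (r : Fin n → F) : (mk 0 0 r : EvenHeisenberg F m n) ∈
    part F (EvenHeisenberg F m n) 1 := by
  intro k hk
  cases k with
  | y j => exact absurd rfl hk
  | _ => rfl

theorem form_mk_left (p q : Fin m → F) (r : Fin n → F) (w : EvenHeisenberg F m n) :
    form (mk p q r) w = ∑ i, (p i * w (.x' i) - q i * w (.x i)) + ∑ j, r j * w (.y j) := rfl

theorem apply_y_of_mem_zero {v : EvenHeisenberg F m n}
    (hv : v ∈ part F (EvenHeisenberg F m n) 0) (j : Fin n) : v (.y j) = 0 :=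
  hv (.y j) one_ne_zero

theorem apply_x_of_mem_one {v : EvenHeisenberg F m n}
    (hv : v ∈ part F (EvenHeisenberg F m n) 1) (i : Fin m) : v (.x i) = 0 :=
  hv (.x i) zero_ne_one

theorem apply_x'_of_mem_one {v : EvenHeisenberg F m n}
    (hv : v ∈ part F (EvenHeisenberg F m n) 1) (i : Fin m) : v (.x' i) = 0 :=
  hv (.x' i) zero_ne_one

theorem form_even_odd {v w : EvenHeisenberg F m n} (hv : v ∈ part F (EvenHeisenberg F m n) 0)
    (hw : w ∈ part F (EvenHeisenberg F m n) 1) : form v w = 0 := by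
  simp [form, apply_y_of_mem_zero hv, apply_x_of_mem_one hw, apply_x'_of_mem_one hw]

theorem form_odd_even {v w : EvenHeisenberg F m n} (hv : v ∈ part F (EvenHeisenberg F m n) 1)
    (hw : w ∈ part F (EvenHeisenberg F m n) 0) : form v w = 0 := by
  simp [form, apply_y_of_mem_zero hw, apply_x_of_mem_one hv, apply_x'_of_mem_one hv]

theorem form_swap_of_even {v w : EvenHeisenberg F m n}
    (hv : v ∈ part F (EvenHeisenberg F m n) 0) : form v w = -form w v := by
  simp only [form, apply_y_of_mem_zero hv, zero_mul, mul_zero, Finset.sum_const_zero, add_zero,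
    ← Finset.sum_neg_distrib]
  exact Finset.sum_congr rfl fun k _ => by ring

theorem form_self_of_even {v : EvenHeisenberg F m n}
    (hv : v ∈ part F (EvenHeisenberg F m n) 0) : form v v = 0 := by
  simp [form, apply_y_of_mem_zero hv, mul_comm]

theorem form_swap_of_odd {v w : EvenHeisenberg F m n}
    (hv : v ∈ part F (EvenHeisenberg F m n) 1) : form v w = form w v := by
  simp [form, apply_x_of_mem_one hv, apply_x'_of_mem_one hv, mul_comm]

/-- The orthogonal complement of two even vectors `a, b` with `[a, b] ≠ 0` is not abelian. -/
theorem exists_orthogonal_of_even (hmn : 2 ≤ m + n) {a b : EvenHeisenberg F m n}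
    (ha : a ∈ part F (EvenHeisenberg F m n) 0) (hb : b ∈ part F (EvenHeisenberg F m n) 0)
    (hab : form a b ≠ 0) :
    ∃ k, ∃ c ∈ part F (EvenHeisenberg F m n) k, ∃ d ∈ part F (EvenHeisenberg F m n) k,
      form c d ≠ 0 ∧ form c a = 0 ∧ form c b = 0 ∧ form d a = 0 ∧ form d b = 0 := by
  rcases Nat.eq_zero_or_pos n with rfl | hn
  -- With no odd vectors, `m ≥ 2`: two conditions on a space of dimension `2m ≥ 4`. Omitting the
  -- `z`-coordinate ensures that a non-zero solution is not central.
  · let φ : ((Fin m → F) × (Fin m → F)) →ₗ[F] F × F :=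
      { toFun := fun p => (form (mk p.1 p.2 0) a, form (mk p.1 p.2 0) b)
        map_add' := fun p q => by
          have h : (mk (p + q).1 (p + q).2 0 : EvenHeisenberg F m 0) =
              mk p.1 p.2 0 + mk q.1 q.2 0 := by
            rw [← mk_add]; simp only [add_zero, Prod.fst_add, Prod.snd_add]
          rw [h, form_add_left, form_add_left]; rfl
        map_smul' := fun s p => by
          have h : (mk (s • p).1 (s • p).2 0 : EvenHeisenberg F m 0) = s • mk p.1 p.2 0 := by
            rw [← mk_smul]; simp only [smul_zero, Prod.smul_fst, Prod.smul_snd]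
          rw [h, form_smul_left, form_smul_left]; rfl }
    obtain ⟨⟨p, q⟩, hpq, hφ⟩ := exists_ne_zero_map_eq_zero φ (by
      rw [Module.finrank_prod, Module.finrank_prod, Module.finrank_self,
        Module.finrank_fin_fun]
      omega)
    set c : EvenHeisenberg F m 0 := mk p q 0 with hcdef
    have hc : c ∈ part F (EvenHeisenberg F m 0) 0 := mk_mem_zero p q
    have hca : form c a = 0 := congrArg Prod.fst hφ
    have hcb : form c b = 0 := congrArg Prod.snd hφ
    obtain ⟨e, he, hce⟩ : ∃ e ∈ part F (EvenHeisenberg F m 0) 0, form c e ≠ 0 := by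
      by_contra! h
      apply hpq
      refine Prod.ext (funext fun i => ?_) (funext fun i => ?_)
      · have := h _ (mk_mem_zero 0 (Pi.single i 1))
        simpa [hcdef, form_mk_left, mk, Pi.single_apply] using this
      · have := h _ (mk_mem_zero (Pi.single i 1) 0)
        simpa [hcdef, form_mk_left, mk, Pi.single_apply] using this
    -- `d` is the projection of `e` away from the hyperbolic plane spanned by `a, b`; as `c` is
    -- orthogonal to that plane, `B(c, d) = B(c, e)`.
    refine ⟨0, c, hc, e + ((-(form e b / form a b)) • a + (form e a / form a b) • b),
      Submodule.add_mem _ he (Submodule.add_mem _ (Submodule.smul_mem _ _ ha)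
        (Submodule.smul_mem _ _ hb)), ?_, hca, hcb, ?_, ?_⟩
    · rwa [form_add_right, form_add_right, form_smul_right, form_smul_right, hca, hcb, mul_zero,
        mul_zero, add_zero, add_zero]
    · rw [form_add_left, form_add_left, form_smul_left, form_smul_left, form_self_of_even ha,
        form_swap_of_even hb]
      field_simp
      ring
    · rw [form_add_left, form_add_left, form_smul_left, form_smul_left, form_self_of_even hb]
      field_simp
      ring
  -- An odd `y_j` is orthogonal to every even vector and has `[y_j, y_j] = z`, so it serves as both
  -- `c` and `d`.
  · have hy := mk_mem_one (F := F) (m := m) (Pi.single (⟨0, hn⟩ : Fin n) (1 : F))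
    refine ⟨1, _, hy, _, hy, ?_, form_odd_even hy ha, form_odd_even hy hb,
      form_odd_even hy ha, form_odd_even hy hb⟩
    simp [form_mk_left, mk, Pi.single_apply]

/-- The orthogonal complement of an anisotropic odd vector is not abelian. -/
theorem exists_orthogonal_of_odd (hmn : 2 ≤ m + n) {a : EvenHeisenberg F m n}
    (ha : a ∈ part F (EvenHeisenberg F m n) 1) (haa : form a a ≠ 0) :
    ∃ k, ∃ c ∈ part F (EvenHeisenberg F m n) k, ∃ d ∈ part F (EvenHeisenberg F m n) k,
      form c d ≠ 0 ∧ form c a = 0 ∧ form d a = 0 := by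
  rcases Nat.eq_zero_or_pos m with rfl | hm
  · let φ : (Fin n → F) →ₗ[F] F :=
      { toFun := fun r => form (mk 0 0 r) a
        map_add' := fun p q => by
          have h : (mk 0 0 (p + q) : EvenHeisenberg F 0 n) = mk 0 0 p + mk 0 0 q := by
            rw [← mk_add]; simp only [add_zero]
          rw [h, form_add_left]
        map_smul' := fun s p => by
          have h : (mk 0 0 (s • p) : EvenHeisenberg F 0 n) = s • mk 0 0 p := by
            rw [← mk_smul]; simp only [smul_zero]
          rw [h, form_smul_left]; rfl }
    obtain ⟨r, hr, hφ⟩ := exists_ne_zero_map_eq_zero φ (by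
      rw [Module.finrank_self, Module.finrank_fin_fun]; omega)
    set c : EvenHeisenberg F 0 n := mk 0 0 r with hcdef
    have hc : c ∈ part F (EvenHeisenberg F 0 n) 1 := mk_mem_one r
    have hca : form c a = 0 := hφ
    obtain ⟨e, he, hce⟩ : ∃ e ∈ part F (EvenHeisenberg F 0 n) 1, form c e ≠ 0 := by
      by_contra! h
      apply hr
      funext j
      have := h _ (mk_mem_one (Pi.single j 1))
      simpa [hcdef, form_mk_left, mk, Pi.single_apply] using this
    -- Gram–Schmidt: `e` is made orthogonal to the anisotropic `a` without changing its pairing with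
    -- `c`.
    refine ⟨1, c, hc, e + (-(form e a / form a a)) • a,
      Submodule.add_mem _ he (Submodule.smul_mem _ _ ha), ?_, hca, ?_⟩
    · rwa [form_add_right, form_smul_right, hca, mul_zero, add_zero]
    · rw [form_add_left, form_smul_left]
      field_simp
      ring
  · have hx := mk_mem_zero (F := F) (n := n) (Pi.single (⟨0, hm⟩ : Fin m) (1 : F)) 0
    have hx' := mk_mem_zero (F := F) (n := n) 0 (Pi.single (⟨0, hm⟩ : Fin m) (1 : F))
    refine ⟨0, _, hx, _, hx', ?_, form_even_odd hx ha, form_even_odd hx' ha⟩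
    simp [form_mk_left, mk, Pi.single_apply]

/-- Polarization: if `2` is invertible, an odd subspace on which the form is non-zero contains an
anisotropic vector. -/
theorem exists_form_self_ne_zero (h2 : (2 : F) ≠ 0) {V : Submodule F (EvenHeisenberg F m n)}
    (hV : V ≤ part F (EvenHeisenberg F m n) 1) {a b : EvenHeisenberg F m n} (ha : a ∈ V)
    (hb : b ∈ V) (hab : form a b ≠ 0) : ∃ v ∈ V, form v v ≠ 0 := by
  by_contra! h
  have hs := h (a + b) (V.add_mem ha hb)
  rw [form_add_left, form_add_right, form_add_right, h a ha, h b hb,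
    form_swap_of_odd (hV hb), zero_add, add_zero, ← two_mul] at hs
  exact (mul_ne_zero h2 hab) hs

theorem not_isCapablePair (h2 : (2 : F) ≠ 0) (hmn : 2 ≤ m + n)
    {I : Submodule F (EvenHeisenberg F m n)} (hI : IsGradedIdeal I) (hna : ¬ IsAbelian I) :
    ¬ IsCapablePair.{u, v, u} I := by
  obtain ⟨i, j, a, ha, b, hb, hab⟩ := hI.exists_part_bracket_ne_zero hna
  have hab' : form a b ≠ 0 := (bracket_eq_zero_iff a b).not.1 hab
  have hi : ∀ i : ZMod 2, i = 0 ∨ i = 1 := by decide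
  rcases hi i with rfl | rfl <;> rcases hi j with rfl | rfl
  · obtain ⟨k, c, hc, d, hd, hcd, hca, hcb, hda, hdb⟩ :=
      exists_orthogonal_of_even hmn ha.2 hb.2 hab'
    rw [Ne, ← bracket_eq_zero_iff] at hcd
    rw [← bracket_eq_zero_iff] at hca hcb hda hdb
    exact not_isCapablePair_of_commuting exists_bracket_eq_smul ha hb hc hd hab hcd
      hca hcb hda hdb
  · exact absurd (form_even_odd ha.2 hb.2) hab'
  · exact absurd (form_odd_even ha.2 hb.2) hab'
  -- Replacing the pair by `a = b = v` leaves a single orthogonality condition. For `m = 0`, `n = 2`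
  -- there is no room for two, since independent `a, b` could span the whole odd part.
  · obtain ⟨v, hv, hvv⟩ := exists_form_self_ne_zero h2 inf_le_right ha hb hab'
    obtain ⟨k, c, hc, d, hd, hcd, hcv, hdv⟩ := exists_orthogonal_of_odd hmn hv.2 hvv
    rw [Ne, ← bracket_eq_zero_iff] at hcd hvv
    rw [← bracket_eq_zero_iff] at hcv hdv
    exact not_isCapablePair_of_commuting exists_bracket_eq_smul hv hv hc hd hvv hcd
      hcv hcv hdv hdv

end EvenHeisenberg

/-! ### The form on `H_m`: orthogonal complements and non-capability -/

namespace OddHeisenberg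

variable {F : Type u} [Field F] {m : ℕ}

theorem bracket_eq_central (v w : OddHeisenberg F m) :
    bracket F v w = central (form v w) := rfl

theorem bracket_eq_zero_iff (v w : OddHeisenberg F m) :
    bracket F v w = 0 ↔ form v w = 0 := by
  rw [bracket_eq_central]
  refine ⟨fun h => congrFun h .z, fun h => ?_⟩
  rw [h]; funext k; cases k <;> rfl

theorem exists_bracket_eq_smul (e f v w : OddHeisenberg F m) (h : bracket F e f ≠ 0) :
    ∃ s : F, bracket F v w = s • bracket F e f := by
  rw [Ne, bracket_eq_zero_iff] at h
  refine ⟨form v w / form e f, ?_⟩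
  rw [bracket_eq_central, bracket_eq_central]
  funext k
  cases k
  · exact (mul_zero _).symm
  · exact (mul_zero _).symm
  · exact (div_mul_cancel₀ _ h).symm

/-- The vector with given coordinates and no `z`-component. -/
def mk (p q : Fin m → F) : OddHeisenberg F m
  | .x i => p i
  | .y i => q i
  | .z => 0

theorem mk_mem_zero (p : Fin m → F) : mk p 0 ∈ part F (OddHeisenberg F m) 0 := by
  intro k hk
  cases k with
  | x i => exact absurd rfl hk
  | _ => rfl

theorem mk_mem_one (q : Fin m → F) : mk 0 q ∈ part F (OddHeisenberg F m) 1 := by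
  intro k hk
  cases k with
  | x i => rfl
  | _ => exact absurd rfl hk

theorem form_mk_left (p q : Fin m → F) (w : OddHeisenberg F m) :
    form (mk p q) w = ∑ i, (p i * w (.y i) - q i * w (.x i)) := rfl

/-- Since `z` is odd, only opposite parities pair. With `form_odd_odd` this makes half of the
orthogonality conditions automatic. -/
theorem form_even_even {v w : OddHeisenberg F m} (hv : v ∈ part F (OddHeisenberg F m) 0)
    (hw : w ∈ part F (OddHeisenberg F m) 0) : form v w = 0 := by
  have h1 : ∀ i, v (.y i) = 0 := fun i => hv (.y i) one_ne_zero
  have h2 : ∀ i, w (.y i) = 0 := fun i => hw (.y i) one_ne_zero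
  simp [form, h1, h2]

theorem form_odd_odd {v w : OddHeisenberg F m} (hv : v ∈ part F (OddHeisenberg F m) 1)
    (hw : w ∈ part F (OddHeisenberg F m) 1) : form v w = 0 := by
  have h1 : ∀ i, v (.x i) = 0 := fun i => hv (.x i) zero_ne_one
  have h2 : ∀ i, w (.x i) = 0 := fun i => hw (.x i) zero_ne_one
  simp [form, h1, h2]

/-- The orthogonal complement of `a, b` with `[a, b] ≠ 0` is not abelian. -/
theorem exists_orthogonal (hm : 2 ≤ m) {a b : OddHeisenberg F m}
    (ha : a ∈ part F (OddHeisenberg F m) 0) (hb : b ∈ part F (OddHeisenberg F m) 1)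
    (hab : form a b ≠ 0) :
    ∃ c ∈ part F (OddHeisenberg F m) 0, ∃ d ∈ part F (OddHeisenberg F m) 1,
      form c d ≠ 0 ∧ form c a = 0 ∧ form c b = 0 ∧ form d a = 0 ∧ form d b = 0 := by
  -- An even `c` is orthogonal to `a` by parity, so only `B(c, b) = 0` is imposed, one condition in
  -- dimension `m ≥ 2`.
  let φ : (Fin m → F) →ₗ[F] F :=
    { toFun := fun p => form (mk p 0) b
      map_add' := fun p q => by
        have h : mk (p + q) 0 = mk p 0 + mk q 0 := by
          funext k; cases k <;> simp [mk]
        rw [h, form_add_left]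
      map_smul' := fun s p => by
        have h : mk (s • p) 0 = s • mk p 0 := by
          funext k; cases k <;> simp [mk]
        rw [h, form_smul_left]; rfl }
  obtain ⟨p, hp, hφ⟩ := exists_ne_zero_map_eq_zero φ (by
    rw [Module.finrank_self, Module.finrank_fin_fun]; omega)
  have hc := mk_mem_zero p
  have hcb : form (mk p 0) b = 0 := hφ
  obtain ⟨e, he, hce⟩ : ∃ e ∈ part F (OddHeisenberg F m) 1, form (mk p 0) e ≠ 0 := by
    by_contra! h
    apply hp
    funext i
    have := h _ (mk_mem_one (Pi.single i 1))
    simpa [form_mk_left, mk, Pi.single_apply] using this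
  -- Only the pairing with `a` needs correcting; the sign is positive because `B(b, a) = -B(a, b)`.
  have hd : e + (form e a / form a b) • b ∈ part F (OddHeisenberg F m) 1 :=
    Submodule.add_mem _ he (Submodule.smul_mem _ _ hb)
  refine ⟨_, hc, _, hd, ?_, form_even_even hc ha, hcb, ?_, form_odd_odd hd hb⟩
  · simpa [form_add_right, form_smul_right, hcb] using hce
  · rw [form_add_left, form_smul_left, form_swap b a]
    field_simp
    ring

theorem not_isCapablePair (hm : 2 ≤ m) {I : Submodule F (OddHeisenberg F m)}
    (hI : IsGradedIdeal I) (hna : ¬ IsAbelian I) : ¬ IsCapablePair.{u, v, u} I := by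
  obtain ⟨i, j, a, ha, b, hb, hab⟩ := hI.exists_part_bracket_ne_zero hna
  have hab' : form a b ≠ 0 := (bracket_eq_zero_iff a b).not.1 hab
  have key : ∀ a ∈ I ⊓ part F (OddHeisenberg F m) 0, ∀ b ∈ I ⊓ part F (OddHeisenberg F m) 1,
      form a b ≠ 0 → ¬ IsCapablePair.{u, v, u} I := by
    intro a ha b hb hab
    obtain ⟨c, hc, d, hd, hcd, hca, hcb, hda, hdb⟩ := exists_orthogonal hm ha.2 hb.2 hab
    rw [Ne, ← bracket_eq_zero_iff] at hcd hab
    rw [← bracket_eq_zero_iff] at hca hcb hda hdb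
    exact not_isCapablePair_of_commuting exists_bracket_eq_smul ha hb hc hd hab hcd
      hca hcb hda hdb
  have hi : ∀ i : ZMod 2, i = 0 ∨ i = 1 := by decide
  rcases hi i with rfl | rfl <;> rcases hi j with rfl | rfl
  · exact absurd (form_even_even ha.2 hb.2) hab'
  · exact key a ha b hb hab'
  · exact key b hb a ha (by rw [form_swap]; exact neg_ne_zero.2 hab')
  · exact absurd (form_odd_odd ha.2 hb.2) hab'

end OddHeisenberg

theorem mainTheorem8 (F : Type u) [Field F] (h2 : ringChar F ≠ 2) (h3 : ringChar F ≠ 3) :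
    (∀ m n : ℕ, 2 ≤ m + n → ∀ I : Submodule F (EvenHeisenberg F m n),
      LieSuperalgebra.IsGradedIdeal I → ¬ LieSuperalgebra.IsAbelian I →
        ¬ LieSuperalgebra.IsCapablePair.{u, v, u} I) ∧
    (∀ m : ℕ, 2 ≤ m → ∀ I : Submodule F (OddHeisenberg F m),
      LieSuperalgebra.IsGradedIdeal I → ¬ LieSuperalgebra.IsAbelian I →
        ¬ LieSuperalgebra.IsCapablePair.{u, v, u} I) :=
  ⟨fun _ _ hmn _ hI hna =>
    EvenHeisenberg.not_isCapablePair (Ring.two_ne_zero h2) hmn hI hna,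
   fun _ hm _ hI hna => OddHeisenberg.not_isCapablePair hm hI hna⟩
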